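/- Let $a<b$, $0<\alpha<1$, and let $B:\mathbb R\to\mathbb R$ be a normalization function, i.e. $B>0$ on $[0,1]$ and $B(0)=B(1)=1$. Let $E_\alpha(z)=\sum_{n=0}^\infty \frac{z^n}{\Gamma(\alpha n+1)}$ be the Mittag-Leffler function, and for $f\in H^1(a,b)$ with weak derivative $f'$ let $$({}^{ABC}{}_aD^\alpha f)(t)=\frac{B(\alpha)}{1-\alpha}\int_a^t E_\alpha\!\left[-\frac{\alpha}{1-\alpha}(t-s)^\alpha\right]f'(s)\,ds$$ be its left Caputo fractional derivative with Mittag-Leffler non-singular kernel. Let $p$ be continuous on $[a,b]$ with $p(t)\ge 0$ for all $t\in[a,b]$ and $p(a)\ne 0$. If $u\in H^1(a,b)\cap C[a,b]$ satisfies $$({}^{ABC}{}_aD^\alpha u)(t)+p(t)\,u(t)\le 0\qquad\text{for all } t\in(a,b),$$ then $u(t)\le 0$ for all $t\in[a,b]$. -/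

import Mathlib

open MeasureTheory Set
open scoped ContDiff

noncomputable section

namespace ABC

/-- The one-parameter Mittag-Leffler function `E_α(z) = ∑ zⁿ / Γ(α n + 1)` at a real argument;
the series converges for every real `z` when `α > 0`. -/
def mittagLeffler (α z : ℝ) : ℝ := ∑' n : ℕ, z ^ n / Real.Gamma (α * n + 1)

/-- `g` is a weak (distributional) derivative of `f` on the open interval `(a, b)`. -/
structure IsWeakDeriv (a b : ℝ) (f g : ℝ → ℝ) : Prop where
  locallyIntegrableOn : LocallyIntegrableOn f (Ioo a b)
  locallyIntegrableOn_deriv : LocallyIntegrableOn g (Ioo a b)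
  integral_eq : ∀ φ : ℝ → ℝ, ContDiff ℝ ∞ φ → HasCompactSupport φ → tsupport φ ⊆ Ioo a b →
    ∫ s in Ioo a b, f s * deriv φ s = -∫ s in Ioo a b, g s * φ s

/-- `f` belongs to the Sobolev space `H¹(a, b)`. -/
def MemH1 (a b : ℝ) (f : ℝ → ℝ) : Prop :=
  MemLp f 2 (volume.restrict (Ioo a b)) ∧
    ∃ g : ℝ → ℝ, MemLp g 2 (volume.restrict (Ioo a b)) ∧ IsWeakDeriv a b f g

open scoped Classical in
/-- A representative of the weak derivative of `f` on `(a, b)`, which is unique up to a null set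
(and `0` if there is no weak derivative). -/
def weakDeriv (a b : ℝ) (f : ℝ → ℝ) : ℝ → ℝ :=
  if h : ∃ g : ℝ → ℝ, IsWeakDeriv a b f g then h.choose else 0

/-- A normalization function of the Atangana-Baleanu derivative. -/
structure IsNormalization (B : ℝ → ℝ) : Prop where
  pos : ∀ x ∈ Icc (0 : ℝ) 1, 0 < B x
  zero : B 0 = 1
  one : B 1 = 1

/-- The left Caputo fractional derivative of order `α` with Mittag-Leffler non-singular kernel,
based at `a`, of a function `f` on `(a, b)`, evaluated at `t`. -/
def caputoDeriv (B : ℝ → ℝ) (α a b : ℝ) (f : ℝ → ℝ) (t : ℝ) : ℝ :=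
  B α / (1 - α) *
    ∫ s in a..t, mittagLeffler α (-(α / (1 - α)) * (t - s) ^ α) * weakDeriv a b f s

end ABC

end

namespace ABC

open Filter Topology

/-! Put λ = α/(1-α), K(x) = E_α(-λx^α) and W = K * u', so the Caputo derivative is cW with c =
B(α)/(1-α) > 0. Convolving the identity K + λI^αK = 1 (`mittagLeffler_add_abel_integral`) with u'
gives u = W + z, where z = u(a) + λI^αW (`memoryIntegral_add_abel_integral`,
`IsWeakDeriv.integral_eq_sub`). The hypothesis becomes (c + p)W ≤ -pz. As W is continuous and
vanishes at a, letting t → a gives p(a)u(a) ≤ 0, hence u(a) ≤ 0.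

Suppose z has a positive maximum at t₀. Then z > 0, and so W ≤ 0, just before t₀, while I^αW(t₀) > 0
because u(a) ≤ 0. This contradicts a maximum principle for I^αW (`abelIntegral_nonpos_of_max`),
which rests on recovering W from I^αW by Marchaud's formula. Hence z ≤ 0, and (c + p)u ≤ cz ≤ 0. -/

/-! ### Convergence and continuity of the Mittag-Leffler series -/

/-- Keep only (R, R + 1] in the Gamma integral. Since R is arbitrary, Γ outgrows every geometric
sequence. -/
lemma rpow_mul_exp_le_Gamma {R x : ℝ} (hR : 0 < R) (hx : 0 ≤ x) :
    R ^ x * Real.exp (-(R + 1)) ≤ Real.Gamma (x + 1) := by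
  rw [Real.Gamma_eq_integral (by linarith)]
  have hint := Real.GammaIntegral_convergent (s := x + 1) (by linarith)
  have hsub : Ioc R (R + 1) ⊆ Ioi 0 := fun y hy => hR.trans hy.1
  calc R ^ x * Real.exp (-(R + 1))
      = ∫ _ in Ioc R (R + 1), Real.exp (-(R + 1)) * R ^ x := by simp [mul_comm]
    _ ≤ ∫ y in Ioc R (R + 1), Real.exp (-y) * y ^ (x + 1 - 1) := by
        refine setIntegral_mono_on (integrableOn_const (by simp)) (hint.mono_set hsub) measurableSet_Ioc ?_
        intro y hy
        rw [add_sub_cancel_right]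
        gcongr
        · exact hy.2
        · exact hy.1.le
    _ ≤ _ := by
        refine setIntegral_mono_set hint ?_ (ae_of_all _ hsub)
        filter_upwards [ae_restrict_mem measurableSet_Ioi] with y hy
        have : (0 : ℝ) < y := hy
        simp only [Pi.zero_apply]
        positivity

lemma summable_pow_div_Gamma {α : ℝ} (hα : 0 < α) (x : ℝ) :
    Summable fun n : ℕ => |x| ^ n / Real.Gamma (α * n + 1) := by
  -- Chosen so that R^α = 2|x| + 1, which gives a geometric majorant of ratio |x|/(2|x| + 1) < 1.
  set R : ℝ := (2 * |x| + 1) ^ α⁻¹ with hRdef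
  have hbase : 0 < 2 * |x| + 1 := by positivity
  have hR : 0 < R := by positivity
  have hRα : R ^ α = 2 * |x| + 1 := by
    rw [hRdef, ← Real.rpow_mul hbase.le, inv_mul_cancel₀ hα.ne', Real.rpow_one]
  have hq : |x| / (2 * |x| + 1) < 1 := by
    rw [div_lt_one hbase]; linarith [abs_nonneg x]
  refine Summable.of_nonneg_of_le (fun n => ?_) (fun n => ?_)
    ((summable_geometric_of_lt_one (by positivity) hq).mul_left (Real.exp (R + 1)))
  · have := Real.Gamma_pos_of_pos (s := α * n + 1) (by positivity)
    positivity
  · have h := rpow_mul_exp_le_Gamma hR (x := α * n) (by positivity)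
    rw [Real.rpow_mul hR.le, hRα, Real.rpow_natCast] at h
    have h0 : 0 < (2 * |x| + 1) ^ n * Real.exp (-(R + 1)) := by positivity
    refine (div_le_div_of_nonneg_left (by positivity) h0 h).trans (le_of_eq ?_)
    rw [Real.exp_neg, div_pow]
    field_simp

lemma continuous_mittagLeffler {α : ℝ} (hα : 0 < α) : Continuous (mittagLeffler α) := by
  rw [continuous_iff_continuousAt]
  intro x
  have hc : ContinuousOn (mittagLeffler α) (Metric.ball 0 (|x| + 1)) := by
    refine continuousOn_tsum (fun n => by fun_prop) (summable_pow_div_Gamma hα (|x| + 1)) ?_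
    intro n y hy
    have hG := Real.Gamma_pos_of_pos (s := α * n + 1) (by positivity)
    rw [Metric.mem_ball, dist_zero_right, Real.norm_eq_abs] at hy
    rw [norm_div, norm_pow, Real.norm_eq_abs, Real.norm_eq_abs, abs_of_pos hG,
      abs_of_nonneg (by positivity : (0 : ℝ) ≤ |x| + 1)]
    gcongr
  exact hc.continuousAt (Metric.isOpen_ball.mem_nhds (by simp))

/-! ### The Abel-Volterra equation of the kernel -/

lemma intervalIntegrable_sub_rpow {α : ℝ} (hα : 0 < α) (x b c : ℝ) :
    IntervalIntegrable (fun r => (x - r) ^ (α - 1)) volume b c := by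
  have := (intervalIntegral.intervalIntegrable_rpow' (a := x - b) (b := x - c)
    (r := α - 1) (by linarith)).comp_sub_left x
  simpa using this

lemma integral_sub_rpow_mul_rpow {α β x : ℝ} (hα : 0 < α) (hβ : 0 ≤ β) (hx : 0 < x) :
    ∫ r in (0 : ℝ)..x, (x - r) ^ (α - 1) * r ^ β =
      x ^ (β + α) * (Real.Gamma α * Real.Gamma (β + 1) / Real.Gamma (β + α + 1)) := by
  have h := Complex.betaIntegral_scaled ((β + 1 : ℝ) : ℂ) (α : ℂ) hx
  rw [Complex.betaIntegral_eq_Gamma_mul_div _ _ (by simpa using by linarith) (by simpa using hα),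
    ← Complex.ofReal_add, Complex.Gamma_ofReal, Complex.Gamma_ofReal, Complex.Gamma_ofReal] at h
  have hl : ∫ r in (0 : ℝ)..x, (r : ℂ) ^ (((β + 1 : ℝ) : ℂ) - 1) * ((x : ℂ) - r) ^ ((α : ℂ) - 1)
      = ((∫ r in (0 : ℝ)..x, (x - r) ^ (α - 1) * r ^ β : ℝ) : ℂ) := by
    rw [← intervalIntegral.integral_ofReal]
    refine intervalIntegral.integral_congr fun r hr => ?_
    rw [uIcc_of_le hx.le] at hr
    have h1 : ((β + 1 : ℝ) : ℂ) - 1 = (β : ℂ) := by push_cast; ring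
    have h2 : (α : ℂ) - 1 = ((α - 1 : ℝ) : ℂ) := by push_cast; ring
    simp only [h1, h2]
    rw [← Complex.ofReal_sub, ← Complex.ofReal_cpow hr.1,
      ← Complex.ofReal_cpow (sub_nonneg.2 hr.2)]
    push_cast; ring
  rw [hl] at h
  have h3 : ((β + 1 + α : ℝ) : ℂ) - 1 = ((β + α : ℝ) : ℂ) := by push_cast; ring
  rw [h3, ← Complex.ofReal_cpow hx.le] at h
  have h4 : β + 1 + α = β + α + 1 := by ring
  rw [h4] at h
  rw [mul_comm (Real.Gamma α)]
  exact_mod_cast h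

/-- The function `x ↦ E_α(-l x^α)` solves the Abel-Volterra equation of the second kind
`K + l I^α K = 1`. -/
lemma mittagLeffler_add_abel_integral {α x : ℝ} (hα : 0 < α) (hx : 0 ≤ x) (l : ℝ) :
    mittagLeffler α (-l * x ^ α) + l / Real.Gamma α *
      ∫ r in (0 : ℝ)..x, (x - r) ^ (α - 1) * mittagLeffler α (-l * r ^ α) = 1 := by
  have hΓα := Real.Gamma_pos_of_pos hα
  have hΓ : ∀ n : ℕ, 0 < Real.Gamma (α * n + 1) := fun n =>
    Real.Gamma_pos_of_pos (by positivity)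
  set f : ℕ → ℝ := fun n => (-l * x ^ α) ^ n / Real.Gamma (α * n + 1) with hf
  have hsum : Summable f := by
    refine Summable.of_norm_bounded (summable_pow_div_Gamma hα (-l * x ^ α)) fun n => ?_
    rw [norm_div, norm_pow, Real.norm_eq_abs, Real.norm_eq_abs, abs_of_pos (hΓ n)]
  have hf0 : f 0 = 1 := by simp [hf]
  rcases hx.eq_or_lt with rfl | hx'
  · have : ∀ n ∉ ({0} : Finset ℕ), f n = 0 := by
      intro n hn
      simp only [Finset.mem_singleton] at hn
      simp [hf, Real.zero_rpow hα.ne', hn]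
    simp only [intervalIntegral.integral_same, mul_zero, add_zero]
    change ∑' n, f n = 1
    rw [tsum_eq_sum this]; simp [hf0]
  have hint : HasSum (fun n : ℕ => ∫ r in (0 : ℝ)..x,
      (x - r) ^ (α - 1) * ((-l * r ^ α) ^ n / Real.Gamma (α * n + 1)))
      (∫ r in (0 : ℝ)..x, (x - r) ^ (α - 1) * mittagLeffler α (-l * r ^ α)) := by
    refine intervalIntegral.hasSum_integral_of_dominated_convergence
      (fun n r => (x - r) ^ (α - 1) * (|l * x ^ α| ^ n / Real.Gamma (α * n + 1))) ?_ ?_ ?_ ?_ ?_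
    · intro n
      refine Measurable.aestronglyMeasurable ?_
      fun_prop
    · intro n
      refine ae_of_all _ fun r hr => ?_
      rw [uIoc_of_le hx] at hr
      have h1 : 0 ≤ x - r := sub_nonneg.2 hr.2
      have h0 : 0 ≤ r := hr.1.le
      rw [norm_mul, norm_div, norm_pow, Real.norm_eq_abs, Real.norm_eq_abs, Real.norm_eq_abs,
        abs_of_pos (hΓ n), abs_of_nonneg (by positivity : 0 ≤ (x - r) ^ (α - 1)), neg_mul, abs_neg,
        abs_mul, abs_mul, abs_of_nonneg (by positivity : 0 ≤ x ^ α),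
        abs_of_nonneg (by positivity : 0 ≤ r ^ α)]
      have := (hΓ n).le
      gcongr
      exact hr.2
    · exact ae_of_all _ fun r _ => (summable_pow_div_Gamma hα (l * x ^ α)).mul_left _
    · simp_rw [tsum_mul_left]
      exact (intervalIntegrable_sub_rpow hα x 0 x).mul_const _
    · refine ae_of_all _ fun r _ => ?_
      refine HasSum.mul_left _ (Summable.hasSum ?_)
      refine Summable.of_norm_bounded (summable_pow_div_Gamma hα (-l * r ^ α)) fun n => ?_
      rw [norm_div, norm_pow, Real.norm_eq_abs, Real.norm_eq_abs, abs_of_pos (hΓ n)]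
  -- By the Beta integral, the Abel operator sends each term of the series to minus the next one, so
  -- only `f 0 = 1` survives in the sum.
  have hterm : ∀ n : ℕ, l / Real.Gamma α * ∫ r in (0 : ℝ)..x,
      (x - r) ^ (α - 1) * ((-l * r ^ α) ^ n / Real.Gamma (α * n + 1)) = - f (n + 1) := by
    intro n
    have hcongr : ∫ r in (0 : ℝ)..x,
        (x - r) ^ (α - 1) * ((-l * r ^ α) ^ n / Real.Gamma (α * n + 1)) =
        ∫ r in (0 : ℝ)..x, (-l) ^ n / Real.Gamma (α * n + 1) *
          ((x - r) ^ (α - 1) * r ^ (α * n)) := by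
      refine intervalIntegral.integral_congr fun r hr => ?_
      rw [uIcc_of_le hx] at hr
      rw [Real.rpow_mul_natCast hr.1, mul_pow]
      ring
    have hpow : (x ^ α) ^ (n + 1) = x ^ (α * n + α) := by
      rw [← Real.rpow_mul_natCast hx]; congr 1; push_cast; ring
    have hG := hΓ (n + 1)
    have hcast : α * ((n + 1 : ℕ) : ℝ) + 1 = α * n + α + 1 := by push_cast; ring
    rw [hcongr, intervalIntegral.integral_const_mul,
      integral_sub_rpow_mul_rpow hα (by positivity) hx', hf]
    simp only [mul_pow (-l)]
    rw [hpow, hcast]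
    rw [hcast] at hG
    have := hΓ n
    field_simp
    ring
  have h2 := hint.mul_left (l / Real.Gamma α)
  simp_rw [hterm] at h2
  rw [← h2.tsum_eq, tsum_neg]
  change ∑' n, f n + _ = 1
  rw [hsum.tsum_eq_zero_add, hf0]
  ring

/-! ### Causal convolution with an integrable function -/

/-- Integrability is asked on the triangle only: kernels such as (r - s)^(α - 1) have no meaning for
s > r. -/
lemma integral_integral_triangle {a T : ℝ} (haT : a ≤ T) {F : ℝ → ℝ → ℝ}
    (hF : Integrable ({q : ℝ × ℝ | q.2 < q.1}.indicator (Function.uncurry F))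
      ((volume.restrict (Ioc a T)).prod (volume.restrict (Ioc a T)))) :
    ∫ r in a..T, ∫ s in a..r, F r s = ∫ s in a..T, ∫ r in s..T, F r s := by
  have hl : ∀ r ∈ Ioc a T, ∫ s in a..r, F r s =
      ∫ s in Ioc a T, {q : ℝ × ℝ | q.2 < q.1}.indicator (Function.uncurry F) (r, s) := by
    intro r hr
    have hset : Ioc a T ∩ Iio r = Ioo a r := by
      ext s; simp only [mem_inter_iff, mem_Ioc, mem_Iio, mem_Ioo]
      exact ⟨fun h => ⟨h.1.1, h.2⟩, fun h => ⟨⟨h.1, h.2.le.trans hr.2⟩, h.2⟩⟩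
    rw [intervalIntegral.integral_of_le hr.1.le, integral_Ioc_eq_integral_Ioo, ← hset,
      ← setIntegral_indicator measurableSet_Iio]
    rfl
  have hr : ∀ s ∈ Ioc a T, ∫ r in s..T, F r s =
      ∫ r in Ioc a T, {q : ℝ × ℝ | q.2 < q.1}.indicator (Function.uncurry F) (r, s) := by
    intro s hs
    have hset : Ioc a T ∩ Ioi s = Ioc s T := by
      ext r; simp only [mem_inter_iff, mem_Ioc, mem_Ioi]
      exact ⟨fun h => ⟨h.2, h.1.2⟩, fun h => ⟨⟨hs.1.trans h.1, h.2⟩, h.1⟩⟩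
    rw [intervalIntegral.integral_of_le hs.2, ← hset, ← setIntegral_indicator measurableSet_Ioi]
    rfl
  rw [intervalIntegral.integral_of_le haT, intervalIntegral.integral_of_le haT,
    setIntegral_congr_fun measurableSet_Ioc hl, setIntegral_congr_fun measurableSet_Ioc hr]
  exact integral_integral_swap hF

/-- The causal convolution `∫_a^t K(t - s) g(s) ds`, extended by zero to `t ≤ a`. -/
noncomputable def memoryIntegral (K g : ℝ → ℝ) (a b t : ℝ) : ℝ :=
  ∫ s in Ioo a b, (if s < t then K (t - s) else 0) * g s

lemma memoryIntegral_eq {K g : ℝ → ℝ} {a b t : ℝ} (hat : a ≤ t) (htb : t ≤ b) :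
    memoryIntegral K g a b t = ∫ s in a..t, K (t - s) * g s := by
  have hset : Ioo a b ∩ Iio t = Ioo a t := by
    ext s; simp only [mem_inter_iff, mem_Ioo, mem_Iio]
    exact ⟨fun h => ⟨h.1.1, h.2⟩, fun h => ⟨⟨h.1, h.2.trans_le htb⟩, h.2⟩⟩
  rw [intervalIntegral.integral_of_le hat, integral_Ioc_eq_integral_Ioo, ← hset,
    ← setIntegral_indicator measurableSet_Iio, memoryIntegral]
  refine integral_congr_ae (ae_of_all _ fun s => ?_)
  by_cases h : s < t <;> simp [h]

lemma continuous_memoryIntegral {K g : ℝ → ℝ} {a b : ℝ} (hK : Continuous K)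
    (hg : IntegrableOn g (Ioo a b)) : Continuous (memoryIntegral K g a b) := by
  rw [continuous_iff_continuousAt]
  intro t₀
  obtain ⟨M, hM⟩ := (isCompact_Icc (a := t₀ - 1 - b) (b := t₀ + 1 - a)).exists_bound_of_continuousOn
    hK.continuousOn
  refine continuousAt_of_dominated (bound := fun s => |M| * ‖g s‖) ?_ ?_ (hg.norm.const_mul _) ?_
  · refine Eventually.of_forall fun t => AEStronglyMeasurable.mul ?_ hg.aestronglyMeasurable
    refine Measurable.aestronglyMeasurable ?_
    exact Measurable.ite measurableSet_Iio (by fun_prop) measurable_const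
  · filter_upwards [Ioo_mem_nhds (sub_one_lt t₀) (lt_add_one t₀)] with t ht
    filter_upwards [ae_restrict_mem measurableSet_Ioo] with s hs
    rw [norm_mul]
    gcongr
    split_ifs
    · exact (hM _ ⟨by linarith [ht.1, hs.2], by linarith [ht.2, hs.1]⟩).trans (le_abs_self M)
    · simp
  -- The cut-off integrand is discontinuous in t at t₀ only for s = t₀, a null set.
  · have : ∀ᵐ s ∂(volume.restrict (Ioo a b)), s ≠ t₀ := by
      refine ae_restrict_of_ae ?_
      simp [ae_iff]
    filter_upwards [this] with s hs
    refine ContinuousAt.mul ?_ continuousAt_const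
    rcases hs.lt_or_gt with h | h
    · have : (fun t => if s < t then K (t - s) else 0) =ᶠ[𝓝 t₀] fun t => K (t - s) := by
        filter_upwards [Ioi_mem_nhds h] with t ht
        exact if_pos ht
      exact (ContinuousAt.congr (by fun_prop) this.symm)
    · have : (fun t => if s < t then K (t - s) else 0) =ᶠ[𝓝 t₀] fun _ => 0 := by
        filter_upwards [Iio_mem_nhds h] with t ht
        exact if_neg (not_lt.2 (le_of_lt ht))
      exact (ContinuousAt.congr continuousAt_const this.symm)

/-- Fubini moves the Abel integral from K * g onto K, where `hKeq` turns it into 1 - K(t - s). -/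
lemma memoryIntegral_add_abel_integral {K g : ℝ → ℝ} {a b t α l : ℝ} (hα : 0 < α)
    (hK : Continuous K)
    (hKeq : ∀ x, 0 ≤ x → K x + l * ∫ r in (0 : ℝ)..x, (x - r) ^ (α - 1) * K r = 1)
    (hg : IntegrableOn g (Ioo a b)) (hat : a ≤ t) (htb : t ≤ b) :
    memoryIntegral K g a b t + l * ∫ r in a..t, (t - r) ^ (α - 1) * memoryIntegral K g a b r
      = ∫ s in a..t, g s := by
  have hgt : IntervalIntegrable g volume a t := by
    rw [intervalIntegrable_iff_integrableOn_Ioo_of_le hat]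
    exact hg.mono_set (Ioo_subset_Ioo_right htb)
  have hKg : IntervalIntegrable (fun s => K (t - s) * g s) volume a t :=
    hgt.continuousOn_mul (by fun_prop)
  obtain ⟨M, hM⟩ := (isCompact_Icc (a := 0) (b := t - a)).exists_bound_of_continuousOn
    hK.continuousOn
  have hswap : ∫ r in a..t, (t - r) ^ (α - 1) * memoryIntegral K g a b r =
      ∫ s in a..t, ∫ r in s..t, (t - r) ^ (α - 1) * (K (r - s) * g s) := by
    rw [← integral_integral_triangle hat]
    · refine intervalIntegral.integral_congr fun r hr => ?_
      rw [uIcc_of_le hat] at hr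
      rw [memoryIntegral_eq hr.1 (hr.2.trans htb), intervalIntegral.integral_const_mul]
    · have h1 := (intervalIntegrable_iff_integrableOn_Ioc_of_le hat).1
        (intervalIntegrable_sub_rpow hα t a t)
      have h2 := (intervalIntegrable_iff_integrableOn_Ioc_of_le hat).1 hgt
      have h3 := Integrable.mul_prod h1 h2
      have h4 : AEStronglyMeasurable ({q : ℝ × ℝ | q.2 < q.1}.indicator fun q => K (q.1 - q.2))
          ((volume.restrict (Ioc a t)).prod (volume.restrict (Ioc a t))) := by
        refine (Measurable.indicator (by fun_prop) ?_).aestronglyMeasurable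
        exact measurableSet_lt measurable_snd measurable_fst
      refine (h3.bdd_mul (c := |M|) h4 ?_).congr (ae_of_all _ fun q => ?_)
      · rw [Measure.prod_restrict]
        filter_upwards [ae_restrict_mem (measurableSet_Ioc.prod measurableSet_Ioc)] with q hq
        by_cases h : q.2 < q.1
        · simp only [indicator, mem_ofPred_eq, h, if_true]
          exact (hM _ ⟨by linarith, by linarith [hq.1.2, hq.2.1]⟩).trans (le_abs_self M)
        · simp [indicator, h]
      · by_cases h : q.2 < q.1
        · simp only [indicator, mem_ofPred_eq, h, if_true, Function.uncurry]; ring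
        · simp [indicator, h]
  have hinner : l * ∫ s in a..t, ∫ r in s..t, (t - r) ^ (α - 1) * (K (r - s) * g s) =
      ∫ s in a..t, (g s - K (t - s) * g s) := by
    rw [← intervalIntegral.integral_const_mul]
    refine intervalIntegral.integral_congr fun s hs => ?_
    rw [uIcc_of_le hat] at hs
    have hsub : ∫ r in s..t, (t - r) ^ (α - 1) * (K (r - s) * g s) =
        (∫ x in (0 : ℝ)..(t - s), ((t - s) - x) ^ (α - 1) * K x) * g s := by
      rw [← intervalIntegral.integral_mul_const, ← sub_self s,
        ← intervalIntegral.integral_comp_sub_right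
          (fun x => ((t - s) - x) ^ (α - 1) * K x * g s) s]
      refine intervalIntegral.integral_congr fun r _ => ?_
      rw [sub_sub_sub_cancel_right]; ring
    have := hKeq (t - s) (sub_nonneg.2 hs.2)
    simp only [hsub]
    linear_combination g s * this
  rw [hswap, hinner, intervalIntegral.integral_sub hgt hKg, memoryIntegral_eq hat htb]
  ring

/-! ### Weak derivatives and the fundamental theorem of calculus -/

lemma integrable_mul_of_tsupport_subset {a b : ℝ} {g φ : ℝ → ℝ}
    (hg : LocallyIntegrableOn g (Ioo a b)) (hφ : Continuous φ) (hc : HasCompactSupport φ)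
    (hs : tsupport φ ⊆ Ioo a b) : Integrable fun x => g x * φ x := by
  have h : IntegrableOn (fun x => g x * φ x) (tsupport φ) :=
    (hg.integrableOn_compact_subset hs hc).mul_continuousOn hφ.continuousOn hc
  refine (integrableOn_iff_integrable_of_support_subset fun x hx => ?_).1 h
  exact subset_tsupport φ (right_ne_zero_of_mul hx)

lemma setIntegral_mul_eq_integral {a b : ℝ} {g φ : ℝ → ℝ} (hs : tsupport φ ⊆ Ioo a b) :
    ∫ x in Ioo a b, g x * φ x = ∫ x, g x * φ x :=
  setIntegral_eq_integral_of_forall_compl_eq_zero fun x hx => by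
    rw [image_eq_zero_of_notMem_tsupport fun h => hx (hs h), mul_zero]

lemma IsWeakDeriv.ae_eq {a b : ℝ} {f g₁ g₂ : ℝ → ℝ} (h₁ : IsWeakDeriv a b f g₁)
    (h₂ : IsWeakDeriv a b f g₂) : g₁ =ᵐ[volume.restrict (Ioo a b)] g₂ := by
  have hl := h₁.locallyIntegrableOn_deriv.sub h₂.locallyIntegrableOn_deriv
  have := isOpen_Ioo.ae_eq_zero_of_integral_contDiff_smul_eq_zero hl fun φ hφ hc hs => by
    have e := (h₁.integral_eq φ hφ hc hs).symm.trans (h₂.integral_eq φ hφ hc hs)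
    rw [neg_inj, setIntegral_mul_eq_integral hs, setIntegral_mul_eq_integral hs] at e
    have i₁ := integrable_mul_of_tsupport_subset h₁.locallyIntegrableOn_deriv hφ.continuous hc hs
    have i₂ := integrable_mul_of_tsupport_subset h₂.locallyIntegrableOn_deriv hφ.continuous hc hs
    rw [← sub_eq_zero, ← integral_sub i₁ i₂] at e
    rw [← e]
    refine integral_congr_ae (ae_of_all _ fun x => ?_)
    simp only [Pi.sub_apply, smul_eq_mul]; ring
  rw [Filter.EventuallyEq, ae_restrict_iff' measurableSet_Ioo]
  filter_upwards [this] with x hx hmem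
  exact sub_eq_zero.1 (hx hmem)

lemma MemH1.isWeakDeriv_weakDeriv {a b : ℝ} {u : ℝ → ℝ} (hu : MemH1 a b u) :
    IsWeakDeriv a b u (weakDeriv a b u) := by
  obtain ⟨-, g, -, hg⟩ := hu
  have h : ∃ g, IsWeakDeriv a b u g := ⟨g, hg⟩
  rw [weakDeriv, dif_pos h]
  exact h.choose_spec

/-- The chosen representative agrees a.e. with an L² one, and L² ⊆ L¹ on a bounded interval. -/
lemma MemH1.integrableOn_weakDeriv {a b : ℝ} {u : ℝ → ℝ} (hu : MemH1 a b u) :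
    IntegrableOn (weakDeriv a b u) (Ioo a b) := by
  have hw := hu.isWeakDeriv_weakDeriv
  obtain ⟨-, g, hg2, hg⟩ := hu
  have hgi : IntegrableOn g (Ioo a b) := hg2.integrable (by norm_num)
  exact Integrable.congr hgi (hg.ae_eq hw)

lemma exists_Icc_of_isCompact_subset_Ioo {a b : ℝ} (hab : a < b) {s : Set ℝ} (hs : IsCompact s)
    (h : s ⊆ Ioo a b) : ∃ c d, a < c ∧ d < b ∧ s ⊆ Icc c d := by
  rcases s.eq_empty_or_nonempty with rfl | hne
  -- For the empty set the reversed endpoints satisfy both strict bounds.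
  · exact ⟨b, a, hab, hab, empty_subset _⟩
  · exact ⟨sInf s, sSup s, (h (hs.sInf_mem hne)).1, (h (hs.sSup_mem hne)).2,
      fun x hx => ⟨csInf_le hs.bddBelow hx, le_csSup hs.bddAbove hx⟩⟩

/-- The primitive from a vanishes to the left of the support, and to its right because the total
integral is zero. -/
lemma exists_test_antideriv {a b : ℝ} (hab : a < b) {θ : ℝ → ℝ} (hθ : ContDiff ℝ ∞ θ)
    (hc : HasCompactSupport θ) (hs : tsupport θ ⊆ Ioo a b) (h0 : ∫ x, θ x = 0) :
    ∃ φ : ℝ → ℝ, ContDiff ℝ ∞ φ ∧ HasCompactSupport φ ∧ tsupport φ ⊆ Ioo a b ∧ deriv φ = θ := by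
  obtain ⟨c, d, hac, hdb, hcd⟩ := exists_Icc_of_isCompact_subset_Ioo hab hc hs
  have hθz : ∀ x, x ∉ Icc c d → θ x = 0 := fun x hx =>
    image_eq_zero_of_notMem_tsupport fun h => hx (hcd h)
  have hder : ∀ t, HasDerivAt (fun t => ∫ x in a..t, θ x) (θ t) t := fun t =>
    intervalIntegral.integral_hasDerivAt_right (hθ.continuous.intervalIntegrable _ _)
      (hθ.continuous.stronglyMeasurableAtFilter _ _) hθ.continuous.continuousAt
  have hderiv : deriv (fun t => ∫ x in a..t, θ x) = θ := funext fun t => (hder t).deriv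
  have hleft : ∀ t, t < c → ∫ x in a..t, θ x = 0 := by
    intro t ht
    refine intervalIntegral.integral_zero_ae (ae_of_all _ fun x hx => hθz x fun hx' => ?_)
    have : x ≤ max a t := hx.2
    have := max_lt hac ht
    linarith [hx'.1]
  have hright : ∀ t, d < t → ∫ x in a..t, θ x = 0 := by
    intro t ht
    rcases lt_or_ge t c with h | h
    · exact hleft t h
    rw [← h0, intervalIntegral.integral_of_le (hac.le.trans h)]
    refine setIntegral_eq_integral_of_forall_compl_eq_zero fun x hx => hθz x fun hx' => hx ?_
    exact ⟨hac.trans_le hx'.1, hx'.2.trans ht.le⟩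
  have hsupp : tsupport (fun t => ∫ x in a..t, θ x) ⊆ Icc c d := by
    refine closure_minimal (fun t ht => ?_) isClosed_Icc
    by_contra hcon
    rw [mem_Icc, not_and_or, not_le, not_le] at hcon
    exact ht (hcon.elim (hleft t) (hright t))
  refine ⟨fun t => ∫ x in a..t, θ x, ?_, ?_, ?_, hderiv⟩
  · rw [contDiff_infty_iff_deriv, hderiv]
    exact ⟨fun t => (hder t).differentiableAt, hθ⟩
  · exact isCompact_Icc.of_isClosed_subset (isClosed_tsupport _) hsupp
  · exact hsupp.trans (Icc_subset_Ioo hac hdb)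

/-- The **du Bois-Reymond lemma**: a function with vanishing weak derivative is constant. -/
lemma ae_eq_const_of_integral_mul_deriv_eq_zero {a b : ℝ} (hab : a < b) {f : ℝ → ℝ}
    (hf : IntegrableOn f (Ioo a b))
    (h : ∀ φ : ℝ → ℝ, ContDiff ℝ ∞ φ → HasCompactSupport φ → tsupport φ ⊆ Ioo a b →
      ∫ s in Ioo a b, f s * deriv φ s = 0) :
    ∃ m, ∀ᵐ x, x ∈ Ioo a b → f x = m := by
  let β : ContDiffBump ((a + b) / 2) :=
    ⟨(b - a) / 8, (b - a) / 4, by linarith, by linarith⟩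
  set η := β.normed volume
  have hη : ContDiff ℝ ∞ η := β.contDiff_normed
  have hηc : HasCompactSupport η := β.hasCompactSupport_normed
  have hηs : tsupport η ⊆ Ioo a b := by
    rw [β.tsupport_normed_eq, Real.closedBall_eq_Icc]
    exact Icc_subset_Ioo (by change _ < _ - (b - a) / 4; linarith)
      (by change _ + (b - a) / 4 < _; linarith)
  have hη1 : ∫ x, η x = 1 := β.integral_normed
  have hfl := hf.locallyIntegrableOn
  refine ⟨∫ x, f x * η x, ?_⟩
  have key := isOpen_Ioo.ae_eq_zero_of_integral_contDiff_smul_eq_zero (μ := volume)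
    (f := fun x => f x - ∫ x, f x * η x)
    (hfl.sub (continuous_const.locallyIntegrable.locallyIntegrableOn _)) fun ψ hψ hψc hψs => by
    have hcη : HasCompactSupport fun x => (∫ y, ψ y) * η x := hηc.mul_left
    have hθs : tsupport (ψ - fun x => (∫ y, ψ y) * η x) ⊆ Ioo a b := by
      refine (tsupport_sub _ _).trans (union_subset hψs ?_)
      exact (tsupport_mul_subset_right (f := fun _ => ∫ y, ψ y) (g := η)).trans hηs
    have hψi : Integrable ψ := hψ.continuous.integrable_of_hasCompactSupport hψc
    have hηi : Integrable η := hη.continuous.integrable_of_hasCompactSupport hηc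
    -- Subtracting (∫ψ)η makes the integral zero, hence a derivative of a test function; pairing it
    -- with f gives ∫fψ = (∫ψ)(∫fη).
    obtain ⟨φ, hφ, hφc, hφs, hφd⟩ := exists_test_antideriv hab
      (θ := ψ - fun x => (∫ y, ψ y) * η x) (hψ.sub (contDiff_const.mul hη)) (hψc.sub hcη) hθs (by
        simp only [Pi.sub_apply]
        rw [integral_sub hψi (hηi.const_mul _), integral_const_mul, hη1]; ring)
    have h1 := h φ hφ hφc hφs
    rw [hφd, setIntegral_mul_eq_integral hθs] at h1
    have iψ := integrable_mul_of_tsupport_subset hfl hψ.continuous hψc hψs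
    have iη := integrable_mul_of_tsupport_subset hfl hη.continuous hηc hηs
    have h2 : ∫ x, f x * (ψ - fun x => (∫ y, ψ y) * η x) x =
        (∫ x, f x * ψ x) - (∫ y, ψ y) * ∫ x, f x * η x := by
      rw [← integral_const_mul, ← integral_sub iψ (iη.const_mul _)]
      refine integral_congr_ae (ae_of_all _ fun x => ?_)
      simp only [Pi.sub_apply]; ring
    have h3 : ∫ x, ψ x • (f x - ∫ x, f x * η x) =
        (∫ x, f x * ψ x) - (∫ x, ψ x) * ∫ x, f x * η x := by
      rw [← integral_mul_const, ← integral_sub iψ (hψi.mul_const _)]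
      refine integral_congr_ae (ae_of_all _ fun x => ?_)
      simp only [smul_eq_mul]; ring
    rw [h3, ← h2, h1]
  filter_upwards [key] with x hx hmem
  exact sub_eq_zero.1 (hx hmem)

lemma integral_primitive_mul_deriv {a b : ℝ} (hab : a ≤ b) {g φ : ℝ → ℝ}
    (hg : IntegrableOn g (Ioo a b)) (hφ : ContDiff ℝ ∞ φ) (hs : tsupport φ ⊆ Ioo a b) :
    ∫ t in Ioo a b, (∫ s in a..t, g s) * deriv φ t = -∫ s in Ioo a b, g s * φ s := by
  have hg' : IntegrableOn g (Ioc a b) := (integrableOn_Ioc_iff_integrableOn_Ioo).2 hg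
  have hdc : Continuous (deriv φ) := (contDiff_infty_iff_deriv.1 hφ).2.continuous
  have hφb : φ b = 0 := image_eq_zero_of_notMem_tsupport fun h => (hs h).2.false
  rw [← integral_Ioc_eq_integral_Ioo, ← integral_Ioc_eq_integral_Ioo,
    ← intervalIntegral.integral_of_le hab, ← intervalIntegral.integral_of_le hab]
  simp_rw [← intervalIntegral.integral_mul_const]
  rw [integral_integral_triangle hab, ← intervalIntegral.integral_neg]
  · refine intervalIntegral.integral_congr fun s _ => ?_
    rw [intervalIntegral.integral_const_mul, intervalIntegral.integral_deriv_eq_sub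
      (fun x _ => hφ.differentiable (by simp) x) (hdc.intervalIntegrable _ _), hφb]
    ring
  · have h1 : IntegrableOn (deriv φ) (Ioc a b) := hdc.integrableOn_Ioc
    refine Integrable.indicator ?_ (measurableSet_lt measurable_snd measurable_fst)
    refine (Integrable.mul_prod h1 hg').congr (ae_of_all _ fun q => ?_)
    simp only [Function.uncurry]; ring

/-- u and the primitive of g have the same weak derivative, so they differ by a constant a.e.;
continuity makes this hold everywhere, and t = a identifies the constant. -/
lemma IsWeakDeriv.integral_eq_sub {a b : ℝ} (hab : a < b) {u g : ℝ → ℝ}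
    (h : IsWeakDeriv a b u g) (hg : IntegrableOn g (Ioo a b)) (hu : ContinuousOn u (Icc a b))
    {t : ℝ} (ht : t ∈ Icc a b) : ∫ s in a..t, g s = u t - u a := by
  have hgI : IntegrableOn g (Icc a b) := (integrableOn_Icc_iff_integrableOn_Ioo).2 hg
  have hU : ContinuousOn (fun t => ∫ s in a..t, g s) (Icc a b) := by
    have := intervalIntegral.continuousOn_primitive_interval (μ := volume) (f := g) (a := a) (b := b)
      (by rwa [uIcc_of_le hab.le])
    rwa [uIcc_of_le hab.le] at this
  have hf := hu.sub hU
  have hfi : ∀ f : ℝ → ℝ, ContinuousOn f (Icc a b) → IntegrableOn f (Ioo a b) := fun f hf =>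
    hf.integrableOn_Icc.mono_set Ioo_subset_Icc_self
  obtain ⟨m, hm⟩ := ae_eq_const_of_integral_mul_deriv_eq_zero hab (hfi _ hf)
    fun φ hφ hc hs => by
      have hd : ContinuousOn (deriv φ) (Icc a b) :=
        (contDiff_infty_iff_deriv.1 hφ).2.continuous.continuousOn
      simp only [Pi.sub_apply, sub_mul]
      rw [integral_sub (hfi (fun x => u x * deriv φ x) (hu.mul hd))
        (hfi (fun x => (∫ s in a..x, g s) * deriv φ x) (hU.mul hd)), h.integral_eq φ hφ hc hs,
        integral_primitive_mul_deriv hab.le hg hφ hs, sub_self]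
  have hE : EqOn (u - fun t => ∫ s in a..t, g s) (fun _ => m) (Icc a b) := by
    refine Measure.eqOn_Icc_of_ae_eq volume hab.ne ?_ hf continuousOn_const
    rw [Measure.restrict_congr_set Ioo_ae_eq_Icc.symm, Filter.EventuallyEq, ae_restrict_iff' measurableSet_Ioo]
    exact hm
  have h1 := hE ht
  have h2 := hE (left_mem_Icc.2 hab.le)
  simp only [Pi.sub_apply, intervalIntegral.integral_same] at h1 h2
  linarith

/-! ### A maximum principle for the Abel integral -/

/-- The Abel integral `∫_a^t (t - r)^(α - 1) W(r) dr`, without the factor `1 / Γ(α)`. -/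
noncomputable def abelIntegral (α a : ℝ) (W : ℝ → ℝ) (t : ℝ) : ℝ :=
  ∫ r in a..t, (t - r) ^ (α - 1) * W r

lemma continuousOn_abelIntegral {α a b : ℝ} (hα : 0 < α) {W : ℝ → ℝ} (hW : Continuous W)
    (hW0 : ∀ t ≤ a, W t = 0) : ContinuousOn (abelIntegral α a W) (Icc a b) := by
  -- Substituting x = t - r frees the singular weight from t; the vanishing of W before a allows a
  -- fixed upper limit.
  have hrep : ∀ t ∈ Icc a b, abelIntegral α a W t =
      ∫ x in (0 : ℝ)..(b - a), x ^ (α - 1) * W (t - x) := by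
    intro t ht
    have hi : ∀ c d, IntervalIntegrable (fun x => x ^ (α - 1) * W (t - x)) volume c d := fun c d =>
      (intervalIntegral.intervalIntegrable_rpow' (by linarith)).mul_continuousOn (by fun_prop)
    have h1 := intervalIntegral.integral_comp_sub_left (a := a) (b := t)
      (fun x => x ^ (α - 1) * W (t - x)) t
    simp only [sub_sub_cancel, sub_self] at h1
    rw [abelIntegral, h1, ← intervalIntegral.integral_add_adjacent_intervals (hi 0 (t - a))
      (hi (t - a) (b - a)), left_eq_add]
    refine intervalIntegral.integral_zero_ae (ae_of_all _ fun x hx => ?_)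
    rw [uIoc_of_le (by linarith [ht.2])] at hx
    rw [hW0 _ (by linarith [hx.1]), mul_zero]
  refine ContinuousOn.congr (Continuous.continuousOn ?_) hrep
  rw [continuous_iff_continuousAt]
  intro t₀
  obtain ⟨M, hM⟩ := (isCompact_Icc (a := t₀ - 1 - |b - a|)
    (b := t₀ + 1 + |b - a|)).exists_bound_of_continuousOn hW.continuousOn
  refine intervalIntegral.continuousAt_of_dominated_interval
    (bound := fun x => ‖x ^ (α - 1)‖ * |M|) ?_ ?_ ?_ ?_
  · refine Eventually.of_forall fun t => Measurable.aestronglyMeasurable ?_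
    fun_prop
  · filter_upwards [Ioo_mem_nhds (sub_one_lt t₀) (lt_add_one t₀)] with t ht
    refine ae_of_all _ fun x hx => ?_
    have hx' : |x| ≤ |b - a| := by
      have := abs_sub_left_of_mem_uIcc (uIoc_subset_uIcc hx)
      simpa using this
    have hx1 := abs_le.1 hx'
    rw [norm_mul]
    gcongr
    exact (hM _ ⟨by linarith [ht.1, hx1.2], by linarith [ht.2, hx1.1]⟩).trans (le_abs_self M)
  · exact (intervalIntegral.intervalIntegrable_rpow' (by linarith)).norm.mul_const _
  · exact ae_of_all _ fun x _ => by fun_prop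

/-- The function (s - r)^α (t - s)^(-α) / (α(t - r)) is an explicit antiderivative, since (s - r) +
(t - s) = t - r. -/
lemma integral_sub_rpow_neg_mul_rpow {α r T t : ℝ} (hα : 0 < α) (hrT : r ≤ T) (hTt : T < t) :
    ∫ s in r..T, (t - s) ^ (-α - 1) * (s - r) ^ (α - 1) =
      (T - r) ^ α * (t - T) ^ (-α) / (α * (t - r)) := by
  have htr : 0 < t - r := by linarith
  have hderiv : ∀ s ∈ Ioo r T, HasDerivAt (fun s => (s - r) ^ α * (t - s) ^ (-α) / (α * (t - r)))
      ((t - s) ^ (-α - 1) * (s - r) ^ (α - 1)) s := by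
    intro s hs
    have hsr : 0 < s - r := sub_pos.2 hs.1
    have hts : 0 < t - s := by linarith [hs.2]
    have h1 : HasDerivAt (fun s => (s - r) ^ α) (1 * α * (s - r) ^ (α - 1)) s :=
      ((hasDerivAt_id s).sub_const r).rpow_const (Or.inl hsr.ne')
    have h2 : HasDerivAt (fun s => (t - s) ^ (-α)) (-1 * (-α) * (t - s) ^ (-α - 1)) s :=
      ((hasDerivAt_id s).const_sub t).rpow_const (Or.inl hts.ne')
    refine ((h1.mul h2).div_const (α * (t - r))).congr_deriv ?_
    have e1 : (s - r) ^ α = (s - r) ^ (α - 1) * (s - r) := by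
      rw [← Real.rpow_add_one hsr.ne']; congr 1; ring
    have e2 : (t - s) ^ (-α) = (t - s) ^ (-α - 1) * (t - s) := by
      rw [← Real.rpow_add_one hts.ne']; congr 1; ring
    rw [e1, e2]
    field_simp
    ring
  have hcts : ∀ e : ℝ, ContinuousOn (fun s => (t - s) ^ e) (Icc r T) := fun e =>
    ContinuousOn.rpow_const (by fun_prop) fun s hs => Or.inl (by linarith [hs.2])
  rw [intervalIntegral.integral_eq_sub_of_hasDerivAt_of_le hrT _ hderiv]
  · simp [Real.zero_rpow hα.ne']
  · have : IntervalIntegrable (fun s => (s - r) ^ (α - 1)) volume r T := by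
      have := (intervalIntegral.intervalIntegrable_rpow' (a := 0) (b := T - r)
        (r := α - 1) (by linarith)).comp_sub_right r
      simpa using this
    exact this.continuousOn_mul (by rw [uIcc_of_le hrT]; exact hcts _)
  · refine ContinuousOn.div_const (ContinuousOn.mul ?_ (hcts _)) _
    exact ContinuousOn.rpow_const (by fun_prop) fun s _ => Or.inr hα.le

lemma integral_sub_rpow_neg_mul_abelIntegral {α a T t : ℝ} (hα : 0 < α) (haT : a ≤ T) (hTt : T < t)
    {W : ℝ → ℝ} (hW : Continuous W) :
    ∫ s in a..T, (t - s) ^ (-α - 1) * abelIntegral α a W s =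
      ∫ r in a..T, (T - r) ^ α * (t - T) ^ (-α) / (α * (t - r)) * W r := by
  have hswap := integral_integral_triangle haT
    (F := fun s r => (t - s) ^ (-α - 1) * ((s - r) ^ (α - 1) * W r)) (by
      -- On the triangle the integrand is a convolution integrand of two L¹ functions times a factor
      -- bounded by (t - T)^(-α - 1).
      have hWi : Integrable ((Ioc a T).indicator W) :=
        (hW.integrableOn_Ioc).integrable_indicator measurableSet_Ioc
      have hki : Integrable ((Ioc 0 (T - a)).indicator fun x : ℝ => x ^ (α - 1)) := by
        refine IntegrableOn.integrable_indicator ?_ measurableSet_Ioc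
        exact (intervalIntegrable_iff_integrableOn_Ioc_of_le (sub_nonneg.2 haT)).1
          (intervalIntegral.intervalIntegrable_rpow' (by linarith))
      have hconv := (hWi.convolution_integrand (ContinuousLinearMap.mul ℝ ℝ) hki).restrict
        (s := Ioc a T ×ˢ Ioc a T)
      rw [← Measure.prod_restrict] at hconv
      refine (hconv.bdd_mul (c := (t - T) ^ (-α - 1)) (f := fun q => (t - q.1) ^ (-α - 1))
        (Measurable.aestronglyMeasurable (by fun_prop)) ?_).congr ?_
      · rw [Measure.prod_restrict]
        filter_upwards [ae_restrict_mem (measurableSet_Ioc.prod measurableSet_Ioc)] with q hq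
        have h1 : 0 < t - T := sub_pos.2 hTt
        have h2 : t - T ≤ t - q.1 := by linarith [hq.1.2]
        rw [Real.norm_of_nonneg (Real.rpow_nonneg (h1.le.trans h2) _)]
        exact Real.rpow_le_rpow_of_nonpos h1 h2 (by linarith)
      · rw [Measure.prod_restrict]
        filter_upwards [ae_restrict_mem (measurableSet_Ioc.prod measurableSet_Ioc)] with q hq
        have hq2 : q.2 ∈ Ioc a T := hq.2
        by_cases h : q.2 < q.1
        · have hm : q.1 - q.2 ∈ Ioc 0 (T - a) :=
            ⟨sub_pos.2 h, by linarith [hq.1.2, hq2.1]⟩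
          have hq' : q ∈ {q : ℝ × ℝ | q.2 < q.1} := h
          simp only [ContinuousLinearMap.mul_apply', indicator_of_mem hq2, indicator_of_mem hm,
            indicator_of_mem hq', Function.uncurry]
          ring
        · have hm : q.1 - q.2 ∉ Ioc 0 (T - a) := fun hh => h (sub_pos.1 hh.1)
          have hq' : q ∉ {q : ℝ × ℝ | q.2 < q.1} := h
          simp [indicator_of_notMem hm, indicator_of_notMem hq'])
  simp_rw [intervalIntegral.integral_const_mul] at hswap
  simp_rw [abelIntegral]
  rw [hswap]
  refine intervalIntegral.integral_congr fun r hr => ?_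
  rw [uIcc_of_le haT] at hr
  simp only [← mul_assoc, intervalIntegral.integral_mul_const]
  rw [integral_sub_rpow_neg_mul_rpow hα hr.2 hTt]

/-- After scaling by x this is y ≤ y^α for y = 1 - ε/x in [0, 1]. -/
lemma sub_rpow_sub_rpow_le {α x ε : ℝ} (hα : α ≤ 1) (hε : 0 ≤ ε) (hx : 0 < x) (hεx : ε ≤ x) :
    x ^ α - (x - ε) ^ α ≤ x ^ (α - 1) * ε := by
  have hy0 : 0 ≤ 1 - ε / x := sub_nonneg.2 ((div_le_one hx).2 hεx)
  have hy1 : 1 - ε / x ≤ 1 := by linarith [div_nonneg hε hx.le]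
  have h1 : (1 - ε / x) ≤ (1 - ε / x) ^ α := Real.self_le_rpow_of_le_one hy0 hy1 hα
  have h2 : x - ε = x * (1 - ε / x) := by field_simp
  have h3 : x ^ α = x ^ (α - 1) * x := by
    rw [← Real.rpow_add_one hx.ne']; congr 1; ring
  rw [h2, Real.mul_rpow hx.le hy0]
  have h4 : x ^ (α - 1) * ε = x ^ α * (ε / x) := by rw [h3]; field_simp
  rw [h4]
  have := Real.rpow_nonneg hx.le α
  nlinarith

/-- A quantitative maximum principle for the Abel integral, from Marchaud's truncated form of its
inverse. -/
lemma abelIntegral_max_bound {α a t δ ε M : ℝ} (hα : 0 < α) (hα1 : α < 1)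
    {W : ℝ → ℝ} (hW : Continuous W) (hW0 : ∀ s ≤ a, W s = 0)
    (hmax : ∀ s ∈ Icc a t, abelIntegral α a W s ≤ abelIntegral α a W t)
    (hWδ : ∀ s ∈ Ioo (t - δ) t, W s ≤ 0) (hM0 : 0 ≤ M) (hM : ∀ s ∈ Icc a t, W s ≤ M)
    (hε : 0 < ε) (hεδ : ε < δ) (hεt : ε < t - a) :
    abelIntegral α a W t * (t - a) ^ (-α) ≤ (δ ^ (α - 2) * M * (t - a)) * ε ^ (1 - α) := by
  set V := abelIntegral α a W with hV
  set T := t - ε with hT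
  have haT : a < T := by linarith
  have hTt : T < t := by linarith
  have htT : t - T = ε := by rw [hT]; ring
  have hcts : ∀ e : ℝ, ContinuousOn (fun s => (t - s) ^ e) (uIcc a T) := fun e => by
    rw [uIcc_of_le haT.le]
    exact ContinuousOn.rpow_const (by fun_prop) fun s hs => Or.inl (by linarith [hs.2])
  have hVc : ContinuousOn V (uIcc a T) := by
    rw [uIcc_of_le haT.le]
    exact continuousOn_abelIntegral hα hW hW0
  -- Maximality replaces V(s) by V(t), and the remaining power integrates exactly.
  have hlow : α * ∫ s in a..T, (t - s) ^ (-α - 1) * V s ≤ V t * (ε ^ (-α) - (t - a) ^ (-α)) := by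
    have h1 : ∫ s in a..T, (t - s) ^ (-α - 1) * V s ≤ ∫ s in a..T, (t - s) ^ (-α - 1) * V t := by
      refine intervalIntegral.integral_mono_on haT.le ((hcts _).mul hVc).intervalIntegrable
        ((hcts _).mul continuousOn_const).intervalIntegrable fun s hs => ?_
      have : 0 ≤ t - s := by linarith [hs.2]
      exact mul_le_mul_of_nonneg_left (hmax s ⟨hs.1, hs.2.trans hTt.le⟩) (by positivity)
    have h2 : ∫ s in a..T, (t - s) ^ (-α - 1) = (ε ^ (-α) - (t - a) ^ (-α)) / α := by
      rw [intervalIntegral.integral_comp_sub_left (fun x => x ^ (-α - 1)) t, integral_rpow, htT]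
      · rw [sub_add_cancel, div_neg, ← neg_div, neg_sub]
      · refine Or.inr ⟨by linarith, ?_⟩
        rw [htT, uIcc_of_le hεt.le]
        exact fun h => absurd h.1 (not_le.2 hε)
    rw [intervalIntegral.integral_mul_const, h2] at h1
    calc _ ≤ α * ((ε ^ (-α) - (t - a) ^ (-α)) / α * V t) := by gcongr
      _ = _ := by field_simp
  have hker : ∀ c d, IntervalIntegrable (fun r => (t - r) ^ (α - 1) * W r) volume c d := fun c d =>
    (intervalIntegrable_sub_rpow hα t c d).mul_continuousOn hW.continuousOn
  have hsplit : V t = (∫ r in a..T, (t - r) ^ (α - 1) * W r) +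
      ∫ r in T..t, (t - r) ^ (α - 1) * W r :=
    (intervalIntegral.integral_add_adjacent_intervals (hker a T) (hker T t)).symm
  have hend : ∫ r in T..t, (t - r) ^ (α - 1) * W r ≤ 0 := by
    rw [intervalIntegral.integral_of_le hTt.le, integral_Ioc_eq_integral_Ioo]
    refine setIntegral_nonpos measurableSet_Ioo fun r hr => ?_
    have h1 : 0 ≤ t - r := by linarith [hr.2]
    exact mul_nonpos_of_nonneg_of_nonpos (by positivity)
      (hWδ r ⟨by linarith [hr.1], hr.2⟩)
  have hfub := integral_sub_rpow_neg_mul_abelIntegral hα haT.le hTt hW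
  rw [htT, ← hV] at hfub
  have hmidint : IntervalIntegrable (fun r => (T - r) ^ α * ε ^ (-α) / (α * (t - r)) * W r)
      volume a T := by
    refine ContinuousOn.intervalIntegrable ?_
    rw [uIcc_of_le haT.le]
    refine ContinuousOn.mul (ContinuousOn.div (ContinuousOn.mul ?_ continuousOn_const)
      (by fun_prop) fun r hr => ?_) hW.continuousOn
    · exact ContinuousOn.rpow_const (by fun_prop) fun s _ => Or.inr hα.le
    · have : 0 < t - r := by linarith [hr.2]
      positivity
  -- The two kernels combine to ε^(-α)((t - r)^α - (t - r - ε)^α)/(t - r) ≥ 0. Only r with W(r) > 0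
  -- matter; these have t - r ≥ δ, where the quotient is at most δ^(α - 2)ε.
  have hmain : ε ^ (-α) * (∫ r in a..T, (t - r) ^ (α - 1) * W r) -
      α * ∫ r in a..T, (T - r) ^ α * ε ^ (-α) / (α * (t - r)) * W r ≤
      δ ^ (α - 2) * M * (t - a) * ε ^ (1 - α) := by
    rw [← intervalIntegral.integral_const_mul, ← intervalIntegral.integral_const_mul,
      ← intervalIntegral.integral_sub ((hker a T).const_mul _) (hmidint.const_mul _)]
    have hδ : 0 < δ := hε.trans hεδ
    calc _ ≤ ∫ _ in a..T, δ ^ (α - 2) * M * ε ^ (1 - α) := by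
          refine intervalIntegral.integral_mono_on haT.le
            (((hker a T).const_mul _).sub (hmidint.const_mul _)) (by simp) fun r hr => ?_
          have hx : 0 < t - r := by linarith [hr.2]
          have hεx : ε ≤ t - r := by linarith [hr.2]
          have hTr : T - r = (t - r) - ε := by rw [hT]; ring
          have hkerpos : 0 ≤ ((t - r) ^ α - (t - r - ε) ^ α) / (t - r) := by
            refine div_nonneg (sub_nonneg.2 ?_) hx.le
            exact Real.rpow_le_rpow (by linarith) (by linarith) hα.le
          have heq : ε ^ (-α) * ((t - r) ^ (α - 1) * W r) -
              α * ((T - r) ^ α * ε ^ (-α) / (α * (t - r)) * W r) =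
              ε ^ (-α) * (((t - r) ^ α - (t - r - ε) ^ α) / (t - r) * W r) := by
            rw [hTr, Real.rpow_sub_one hx.ne']
            field_simp
          rw [heq]
          have hrhs : 0 ≤ δ ^ (α - 2) * M * ε ^ (1 - α) := by positivity
          have hεα : 0 < ε ^ (-α) := by positivity
          rcases le_or_gt (W r) 0 with hWr | hWr
          · exact (mul_nonpos_of_nonneg_of_nonpos hεα.le
              (mul_nonpos_of_nonneg_of_nonpos hkerpos hWr)).trans hrhs
          have hrδ : δ ≤ t - r := by
            by_contra! hcon
            exact absurd (hWδ r ⟨by linarith, by linarith⟩) (not_le.2 hWr)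
          have hk : ((t - r) ^ α - (t - r - ε) ^ α) / (t - r) ≤ δ ^ (α - 2) * ε := by
            have h1 := sub_rpow_sub_rpow_le hα1.le hε.le hx hεx
            have h2 : (t - r) ^ (α - 2) = (t - r) ^ (α - 1) / (t - r) := by
              rw [← Real.rpow_sub_one hx.ne']; congr 1; ring
            have h3 : (t - r) ^ (α - 2) ≤ δ ^ (α - 2) :=
              Real.rpow_le_rpow_of_nonpos hδ hrδ (by linarith)
            calc _ ≤ (t - r) ^ (α - 1) * ε / (t - r) := by gcongr
              _ = (t - r) ^ (α - 2) * ε := by rw [h2]; ring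
              _ ≤ _ := by gcongr
          have hε1 : ε ^ (1 - α) = ε ^ (-α) * ε := by
            rw [← Real.rpow_add_one hε.ne']; congr 1; ring
          calc _ ≤ ε ^ (-α) * (δ ^ (α - 2) * ε * M) := by
                gcongr
                exact hM r ⟨hr.1, hr.2.trans hTt.le⟩
            _ = _ := by rw [hε1]; ring
      _ = (T - a) * (δ ^ (α - 2) * M * ε ^ (1 - α)) := by
          rw [intervalIntegral.integral_const, smul_eq_mul]
      _ ≤ (t - a) * (δ ^ (α - 2) * M * ε ^ (1 - α)) := by gcongr
      _ = _ := by ring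
  rw [hfub] at hlow
  have hεα : 0 < ε ^ (-α) := by positivity
  have hprod := mul_nonpos_of_nonneg_of_nonpos hεα.le hend
  have h5 : ε ^ (-α) * V t = ε ^ (-α) * (∫ r in a..T, (t - r) ^ (α - 1) * W r) +
      ε ^ (-α) * ∫ r in T..t, (t - r) ^ (α - 1) * W r := by rw [hsplit]; ring
  linarith

/-- If the Abel integral of `W` attains its maximum over `[a, t]` at `t`, and `W ≤ 0` shortly
before `t`, then this maximum is not positive. -/
lemma abelIntegral_nonpos_of_max {α a t δ : ℝ} (hα : 0 < α) (hα1 : α < 1) (hat : a < t)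
    {W : ℝ → ℝ} (hW : Continuous W) (hW0 : ∀ s ≤ a, W s = 0)
    (hmax : ∀ s ∈ Icc a t, abelIntegral α a W s ≤ abelIntegral α a W t)
    (hδ : 0 < δ) (hWδ : ∀ s ∈ Ioo (t - δ) t, W s ≤ 0) : abelIntegral α a W t ≤ 0 := by
  obtain ⟨M, hM⟩ := (isCompact_Icc (a := a) (b := t)).exists_bound_of_continuousOn hW.continuousOn
  have hM' : ∀ s ∈ Icc a t, W s ≤ |M| := fun s hs =>
    (le_abs_self _).trans ((hM s hs).trans (le_abs_self M))
  -- As 1 - α > 0, the error in the truncated bound vanishes as ε → 0⁺.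
  have hlim : Tendsto (fun ε : ℝ => (δ ^ (α - 2) * |M| * (t - a)) * ε ^ (1 - α)) (𝓝[>] 0)
      (𝓝 0) := by
    have hc : ContinuousAt (fun ε : ℝ => (δ ^ (α - 2) * |M| * (t - a)) * ε ^ (1 - α)) 0 :=
      continuousAt_const.mul (Real.continuousAt_rpow_const _ _ (Or.inr (by linarith)))
    have := hc.tendsto
    rw [Real.zero_rpow (by linarith), mul_zero] at this
    exact this.mono_left nhdsWithin_le_nhds
  have hle : abelIntegral α a W t * (t - a) ^ (-α) ≤ 0 := by
    refine ge_of_tendsto hlim ?_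
    filter_upwards [Ioo_mem_nhdsGT (lt_min hδ (sub_pos.2 hat))] with ε hε
    exact abelIntegral_max_bound hα hα1 hW hW0 hmax hWδ (abs_nonneg M) hM' hε.1
      (hε.2.trans_le (min_le_left _ _)) (hε.2.trans_le (min_le_right _ _))
  have : 0 < (t - a) ^ (-α) := Real.rpow_pos_of_pos (sub_pos.2 hat) _
  exact nonpos_of_mul_nonpos_left hle this

/-! ### The comparison principle and the theorem -/

lemma memoryIntegral_eq_zero {K g : ℝ → ℝ} {a b t : ℝ} (hta : t ≤ a) :
    memoryIntegral K g a b t = 0 := by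
  refine (setIntegral_congr_fun measurableSet_Ioo fun s hs => ?_).trans (integral_zero _ _)
  simp only [if_neg (not_lt.2 (hta.trans hs.1.le)), zero_mul]

/-- Comparison principle for `u = u(a) + W + l I^α W` with `c W + p u ≤ 0`. -/
lemma nonpos_of_abel_inequality {α a b c l : ℝ} (hα : 0 < α) (hα1 : α < 1) (hab : a < b)
    (hc : 0 < c) (hl : 0 < l) {p u W : ℝ → ℝ} (hp : ContinuousOn p (Icc a b))
    (hp_nonneg : ∀ t ∈ Icc a b, 0 ≤ p t) (hpa : p a ≠ 0) (hu : ContinuousOn u (Icc a b))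
    (hW : Continuous W) (hW0 : ∀ t ≤ a, W t = 0)
    (hvol : ∀ t ∈ Icc a b, W t + l * abelIntegral α a W t = u t - u a)
    (h : ∀ t ∈ Ioo a b, c * W t + p t * u t ≤ 0) :
    ∀ t ∈ Icc a b, u t ≤ 0 := by
  have hIcc : closure (Ioo a b) = Icc a b := closure_Ioo hab.ne
  have ha : a ∈ Icc a b := left_mem_Icc.2 hab.le
  have hua : u a ≤ 0 := by
    have hcont : ContinuousOn (fun t => c * W t + p t * u t) (closure (Ioo a b)) := by
      rw [hIcc]; exact (hW.continuousOn.const_mul c).add (hp.mul hu)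
    have h0 := le_on_closure (g := fun _ => 0) h hcont continuousOn_const (hIcc ▸ ha)
    simp only [hW0 a le_rfl, mul_zero, zero_add] at h0
    have hpos : 0 < p a := lt_of_le_of_ne (hp_nonneg a ha) hpa.symm
    exact nonpos_of_mul_nonpos_right h0 hpos
  have hV := continuousOn_abelIntegral (b := b) hα hW hW0
  have hineq : ∀ t ∈ Ioo a b, (c + p t) * W t ≤ -(p t * (l * abelIntegral α a W t + u a)) := by
    intro t ht
    have h1 := hvol t (Ioo_subset_Icc_self ht)
    have h2 : u t = W t + (l * abelIntegral α a W t + u a) := by linarith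
    have h3 := h t ht
    rw [h2] at h3
    linarith
  have hz : ∀ t ∈ Icc a b, l * abelIntegral α a W t + u a ≤ 0 := by
    obtain ⟨t₀, ht₀, hmax⟩ := isCompact_Icc.exists_isMaxOn ⟨a, ha⟩ hV
    suffices hz₀ : l * abelIntegral α a W t₀ + u a ≤ 0 by
      intro t ht
      have := mul_le_mul_of_nonneg_left (hmax ht) hl.le
      linarith
    by_contra! hpos
    have hVpos : 0 < abelIntegral α a W t₀ := pos_of_mul_pos_right (by linarith) hl.le
    have hat₀ : a < t₀ := by
      refine lt_of_le_of_ne ht₀.1 ?_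
      rintro rfl
      simp [abelIntegral] at hVpos
    have hev : ∀ᶠ t in 𝓝[Icc a b] t₀, 0 < l * abelIntegral α a W t + u a :=
      ((hV.const_mul l).add continuousOn_const t₀ ht₀).eventually_const_lt hpos
    obtain ⟨δ, hδ, hball⟩ := Metric.mem_nhdsWithin_iff.1 hev
    -- The cap t₀ - a keeps the left neighbourhood inside (a, b).
    have hδ' : 0 < min δ (t₀ - a) := lt_min hδ (sub_pos.2 hat₀)
    refine absurd (abelIntegral_nonpos_of_max hα hα1 hat₀ hW hW0
      (fun s hs => hmax ⟨hs.1, hs.2.trans ht₀.2⟩) hδ' fun s hs => ?_) (not_le.2 hVpos)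
    have h1 := min_le_left δ (t₀ - a)
    have h2 := min_le_right δ (t₀ - a)
    have hsab : s ∈ Ioo a b := ⟨by linarith [hs.1], hs.2.trans_le ht₀.2⟩
    have hzs : 0 < l * abelIntegral α a W s + u a := by
      refine hball ⟨?_, Ioo_subset_Icc_self hsab⟩
      rw [Metric.mem_ball, Real.dist_eq, abs_lt]
      constructor <;> linarith [hs.1, hs.2]
    have hps := hp_nonneg s (Ioo_subset_Icc_self hsab)
    have h3 := hineq s hsab
    have h4 := mul_nonneg hps hzs.le
    exact nonpos_of_mul_nonpos_right (h3.trans (by linarith)) (by linarith : 0 < c + p s)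
  have hopen : ∀ t ∈ Ioo a b, u t ≤ 0 := by
    intro t ht
    have hmem := Ioo_subset_Icc_self ht
    have h1 := hvol t hmem
    have h2 := hineq t ht
    have hpt := hp_nonneg t hmem
    -- Adding (c + p)z to (c + p)W ≤ -pz cancels pz.
    have h3 : (c + p t) * u t ≤ c * (l * abelIntegral α a W t + u a) := by
      have : u t = W t + (l * abelIntegral α a W t + u a) := by linarith
      rw [this]; linarith
    have h4 := mul_nonpos_of_nonneg_of_nonpos hc.le (hz t hmem)
    exact nonpos_of_mul_nonpos_right (h3.trans h4) (by linarith : 0 < c + p t)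
  intro t ht
  exact le_on_closure (g := fun _ => 0) hopen (by rwa [hIcc]) continuousOn_const (hIcc ▸ ht)

end ABC

theorem lemma3p1 (B : ℝ → ℝ) (hB : ABC.IsNormalization B)
    (α : ℝ) (hα : α ∈ Set.Ioo (0 : ℝ) 1) (a b : ℝ) (hab : a < b)
    (p : ℝ → ℝ) (hp : ContinuousOn p (Set.Icc a b)) (hp_nonneg : ∀ t ∈ Set.Icc a b, 0 ≤ p t)
    (hpa : p a ≠ 0)
    (u : ℝ → ℝ) (hu : ABC.MemH1 a b u) (hu_cont : ContinuousOn u (Set.Icc a b))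
    (h : ∀ t ∈ Set.Ioo a b, ABC.caputoDeriv B α a b u t + p t * u t ≤ 0) :
    ∀ t ∈ Set.Icc a b, u t ≤ 0 := by
  obtain ⟨hα0, hα1⟩ := hα
  have h1α : 0 < 1 - α := sub_pos.2 hα1
  have hc : 0 < B α / (1 - α) := div_pos (hB.pos α ⟨hα0.le, hα1.le⟩) h1α
  have hlam : 0 < α / (1 - α) := div_pos hα0 h1α
  set K : ℝ → ℝ := fun x => ABC.mittagLeffler α (-(α / (1 - α)) * x ^ α) with hKdef
  have hK : Continuous K :=
    (ABC.continuous_mittagLeffler hα0).comp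
      (continuous_const.mul (Real.continuous_rpow_const hα0.le))
  have hg := hu.integrableOn_weakDeriv
  -- The 1/Γ(α) in `l` is the normalization of I^α that `abelIntegral` omits.
  refine ABC.nonpos_of_abel_inequality (l := α / (1 - α) / Real.Gamma α)
    (W := ABC.memoryIntegral K (ABC.weakDeriv a b u) a b) hα0 hα1 hab hc
    (div_pos hlam (Real.Gamma_pos_of_pos hα0)) hp hp_nonneg hpa hu_cont
    (ABC.continuous_memoryIntegral hK hg) (fun t ht => ABC.memoryIntegral_eq_zero ht) ?_ ?_
  · intro t ht
    rw [← hu.isWeakDeriv_weakDeriv.integral_eq_sub hab hg hu_cont ht]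
    exact ABC.memoryIntegral_add_abel_integral hα0 hK
      (fun x hx => ABC.mittagLeffler_add_abel_integral hα0 hx _) hg ht.1 ht.2
  · intro t ht
    rw [ABC.memoryIntegral_eq ht.1.le ht.2.le]
    exact h t ht
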